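/- Let $N,M\ge 0$ and $K^{(1)},\dots,K^{(N)}$ be integers, $K^{(i)}\ge 1$, and $L=\sum_i K^{(i)}$. For each $i$ let $P^{(i)}\in\{0,1\}^{K^{(i)}\times M}$ be a row-partial permutation matrix, i.e. each row contains exactly one $1$ and each column at most one $1$. Let $P\in\mathbb R^{L\times M}$ be the vertical concatenation of $P^{(1)},\dots,P^{(N)}$, let $Q=PP^\top\in\mathbb R^{L\times L}$ and $C=-Q$. Index rows and columns of $L\times L$ matrices by pairs $(i,k)$, $1\le i\le N$, $1\le k\le K^{(i)}$, and write $X^{(i,j)}\in\mathbb R^{K^{(i)}\times K^{(j)}}$ for the blocks of $X$. For symmetric $X\succeq 0$ let $S(X)=\operatorname{Tr}[X\log X]-\operatorname{Tr}[X]$ be the von Neumann entropy (with $0\log 0=0$). For $\beta>0$ consider the problem $$\text{minimize}\quad \operatorname{Tr}[CX]+\beta^{-1}S(X)\quad\text{over symmetric } X\in\mathbb R^{L\times L},\ X\succeq 0,$$ subject to one of the following sets of constraints: - (strong) $X^{(i,i)}=\mathbf I_{K^{(i)}}$ for all $i$; - (weak) $\operatorname{diag}(X)=\mathbf 1_L$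 and $\operatorname{Tr}\big[X^{(i,i)}\,\mathbf 1_{K^{(i)}}\mathbf 1_{K^{(i)}}^\top/K^{(i)}\big]=1$ for all $i$; - (GW-type) $\operatorname{diag}(X)=\mathbf 1_L$. Then for each of the three problems and each $\beta>0$ there is a unique minimizer $X_\beta$, and $$\lim_{\beta\to\infty}X_\beta=Q.$$ Moreover, with $\mathcal I_m=\{(i,k): P^{(i)}_{km}=1\}$ and $L_m=|\mathcal I_m|$ for $m=1,\dots,M$, in each of the three cases $X_\beta$ is block-diagonal with respect to the partition of the indices into $\mathcal I_1,\dots,\mathcal I_M$ (entries with row in $\mathcal I_m$ and column in $\mathcal I_{m'}$, $m\ne m'$, vanish), and its diagonal blocks are $$[X_\beta]_{\mathcal I_m,\mathcal I_m}=\tau_{\beta,m}\,\mathbf I_{L_m}+(1-\tau_{\beta,m})\,\mathbf 1_{L_m}\mathbf 1_{L_m}^\top,\qquad \tau_{\beta,m}=\frac{L_m}{L_m+e^{\beta L_m}-1}$$ (an empty block when $L_m=0$). -/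

import Mathlib

namespace PermSync

open Matrix

/-- Keypoints `(i, k)`: the `k`-th keypoint of the `i`-th image, image `i` having `K i` of them.
These are the row indices of the large `L × L` matrices, `L = ∑ i, K i`. -/
abbrev Keypoint {N : ℕ} (K : Fin N → ℕ) : Type := Σ i : Fin N, Fin (K i)

/-- A row-partial permutation matrix: entries in `{0, 1}`, exactly one `1` in each row and at most
one `1` in each column; equivalently, a selection of rows of a permutation matrix. -/
structure IsRowPartialPerm {k m : ℕ} (A : Matrix (Fin k) (Fin m) ℝ) : Prop where
  zero_or_one : ∀ a b, A a b = 0 ∨ A a b = 1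
  row : ∀ a, ∃! b, A a b = 1
  column : ∀ a a' b, A a b = 1 → A a' b = 1 → a = a'

/-- The vertical concatenation `P` of the blocks `P⁽¹⁾, …, P⁽ᴺ⁾`. -/
def stack {N M : ℕ} {K : Fin N → ℕ} (P : ∀ i, Matrix (Fin (K i)) (Fin M) ℝ) :
    Matrix (Keypoint K) (Fin M) ℝ :=
  Matrix.of fun p m => P p.1 p.2 m

/-- The uncorrupted data `Q = P Pᵀ`. -/
def data {N M : ℕ} {K : Fin N → ℕ} (P : ∀ i, Matrix (Fin (K i)) (Fin M) ℝ) :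
    Matrix (Keypoint K) (Keypoint K) ℝ :=
  stack P * (stack P)ᵀ

/-- The block `X⁽ⁱʲ⁾` of a large matrix. -/
def block {N : ℕ} {K : Fin N → ℕ} (X : Matrix (Keypoint K) (Keypoint K) ℝ) (i j : Fin N) :
    Matrix (Fin (K i)) (Fin (K j)) ℝ :=
  Matrix.of fun a b => X ⟨i, a⟩ ⟨j, b⟩

/-- The all-ones matrix `1 1ᵀ`. -/
def allOnes (n : Type*) : Matrix n n ℝ := Matrix.of fun _ _ => 1

/-- The von Neumann entropy `S(X) = Tr[X log X] - Tr[X]` of a positive semidefinite matrix. The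
logarithm is the spectral one; as `Real.log 0 = 0`, the convention `0 log 0 = 0` is in force. -/
noncomputable def entropy {n : Type*} [Fintype n] [DecidableEq n] (X : Matrix n n ℝ) : ℝ :=
  (X * cfc Real.log X).trace - X.trace

/-- The regularized objective `Tr[C X] + β⁻¹ S(X)`. -/
noncomputable def objective {n : Type*} [Fintype n] [DecidableEq n]
    (C : Matrix n n ℝ) (β : ℝ) (X : Matrix n n ℝ) : ℝ :=
  (C * X).trace + β⁻¹ * entropy X

/-- The three semidefinite relaxations. -/
inductive Relaxation
  | strong
  | weak
  | gw

/-- The feasible set of each relaxation. -/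
def feasible {N : ℕ} (K : Fin N → ℕ) : Relaxation → Set (Matrix (Keypoint K) (Keypoint K) ℝ)
  | .strong => {X | (∀ i, block X i i = 1) ∧ X.PosSemidef}
  | .weak => {X | (∀ p, X p p = 1) ∧
      (∀ i, (block X i i * ((K i : ℝ)⁻¹ • allOnes (Fin (K i)))).trace = 1) ∧ X.PosSemidef}
  | .gw => {X | (∀ p, X p p = 1) ∧ X.PosSemidef}

/-- `X` solves: minimize `Tr[C X] + β⁻¹ S(X)` over the feasible set of the relaxation `r`. -/
def IsRegSolution {N : ℕ} {K : Fin N → ℕ} (r : Relaxation)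
    (C : Matrix (Keypoint K) (Keypoint K) ℝ) (β : ℝ)
    (X : Matrix (Keypoint K) (Keypoint K) ℝ) : Prop :=
  X ∈ feasible K r ∧ IsMinOn (objective C β) (feasible K r) X

/-- The set `I_m` of keypoints that correspond to the registry point `m`. -/
def registryClass {N M : ℕ} {K : Fin N → ℕ} (P : ∀ i, Matrix (Fin (K i)) (Fin M) ℝ)
    (m : Fin M) : Set (Keypoint K) :=
  {p | P p.1 p.2 m = 1}

/-- The mixing coefficient `τ = L / (L + e^{βL} - 1)`. -/
noncomputable def mixing (β : ℝ) (L : ℕ) : ℝ :=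
  (L : ℝ) / ((L : ℝ) + Real.exp (β * L) - 1)

end PermSync

/-!
Group the keypoints by registry point: on the class `I_m` the data `Q` is `𝟏𝟏ᵀ`, and it vanishes
between different classes. Suppose only the diagonal of `X` is constrained. Stationarity then reads
`log X = β Q + diagonal d`, and a multiplier that is constant, say `log τ`, on a class of size `L`
gives there
`X = exp (log τ • 1 + β • 𝟏𝟏ᵀ) = τ • 1 + (τ (e^{βL} - 1) / L) • 𝟏𝟏ᵀ`,
whose diagonal is `1` exactly when `τ = L / (L + e^{βL} - 1)`. By Klein's inequality and its
equality case, the excess of the objective over its value at this matrix is `β⁻¹` times a relative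
entropy, which is nonnegative and vanishes only there. As an image meets each class at most once,
the matrix even satisfies the strong constraints, so it solves all three problems. Finally `τ → 0`.
-/

namespace PermSync

open Filter InformationTheory Matrix
open scoped Topology

section Spectral

variable {𝕜 n : Type*} [RCLike 𝕜] [Fintype n] [DecidableEq n] {A B : Matrix n n 𝕜}

lemma continuousOn_spectrum (f : ℝ → ℝ) (A : Matrix n n 𝕜) : ContinuousOn f (spectrum ℝ A) :=
  A.finite_real_spectrum.continuousOn f

lemma aeval_mulVec_of_mulVec_eq_smul {v : n → 𝕜} {t : ℝ} (hv : A *ᵥ v = t • v)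
    (p : Polynomial ℝ) : Polynomial.aeval A p *ᵥ v = p.eval t • v := by
  induction p using Polynomial.induction_on' with
  | add p q hp hq => rw [map_add, add_mulVec, hp, hq, Polynomial.eval_add, add_smul]
  | monomial k a =>
    have hpow : A ^ k *ᵥ v = t ^ k • v := by
      induction k with
      | zero => simp
      | succ k ih => rw [pow_succ, ← mulVec_mulVec, hv, mulVec_smul, ih, smul_smul, pow_succ']
    rw [Polynomial.aeval_monomial, ← Algebra.smul_def, smul_mulVec, hpow, smul_smul,
      Polynomial.eval_monomial]

lemma cfc_mulVec_of_mulVec_eq_smul (hA : A.IsHermitian) {v : n → 𝕜} {t : ℝ}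
    (hv : A *ᵥ v = t • v) (f : ℝ → ℝ) : cfc f A *ᵥ v = f t • v := by
  let s : Finset ℝ := insert t A.finite_real_spectrum.toFinset
  let p := Lagrange.interpolate s id f
  have hp : ∀ x ∈ s, p.eval x = f x := fun x hx ↦
    Lagrange.eval_interpolate_at_node f Function.injective_id.injOn hx
  have hcfc : cfc f A = Polynomial.aeval A p := by
    rw [← cfc_polynomial p A hA]
    exact cfc_congr fun x hx ↦ (hp x (by simp [s, hx])).symm
  rw [hcfc, aeval_mulVec_of_mulVec_eq_smul hv, hp t (Finset.mem_insert_self t _)]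

/-- The inner products `⟨u_a, v_b⟩` of the vectors of the orthonormal eigenbases of two Hermitian
matrices, as a unitary matrix; it compares functions of one matrix with functions of the other. -/
noncomputable def eigenvectorOverlap (hA : A.IsHermitian) (hB : B.IsHermitian) :
    unitaryGroup n 𝕜 :=
  star hA.eigenvectorUnitary * hB.eigenvectorUnitary

lemma cfc_eq_eigenvectorUnitary_mul (hA : A.IsHermitian) (f : ℝ → ℝ) :
    cfc f A = (hA.eigenvectorUnitary : Matrix n n 𝕜) *
      diagonal (fun i ↦ (f (hA.eigenvalues i) : 𝕜)) *
        star (hA.eigenvectorUnitary : Matrix n n 𝕜) := by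
  rw [hA.cfc_eq, IsHermitian.cfc, Unitary.conjStarAlgAut_apply]
  rfl

lemma trace_cfc_mul_cfc (hA : A.IsHermitian) (hB : B.IsHermitian) (f g : ℝ → ℝ) :
    (cfc f A * cfc g B).trace = ((∑ a, ∑ b, f (hA.eigenvalues a) * g (hB.eigenvalues b) *
      ‖(eigenvectorOverlap hA hB : Matrix n n 𝕜) a b‖ ^ 2 : ℝ) : 𝕜) := by
  set W : Matrix n n 𝕜 := ↑(eigenvectorOverlap hA hB) with hW
  have htrace : (cfc f A * cfc g B).trace =
      (diagonal (fun a ↦ (f (hA.eigenvalues a) : 𝕜)) * W *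
        (diagonal (fun b ↦ (g (hB.eigenvalues b) : 𝕜)) * star W)).trace := by
    rw [cfc_eq_eigenvectorUnitary_mul hA, cfc_eq_eigenvectorUnitary_mul hB, hW,
      eigenvectorOverlap, UnitaryGroup.mul_val, star_mul, Unitary.coe_star, star_star,
      mul_assoc, mul_assoc, trace_mul_comm]
    simp only [mul_assoc]
  rw [htrace]
  simp only [trace, diag_apply, mul_apply (M := diagonal _ * W), diagonal_mul, star_apply]
  push_cast
  refine Finset.sum_congr rfl fun a _ ↦ Finset.sum_congr rfl fun b _ ↦ ?_
  rw [← RCLike.mul_conj, RCLike.star_def]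
  ring

lemma cfc_eq_cfc_of_overlap (hA : A.IsHermitian) (hB : B.IsHermitian) {f g : ℝ → ℝ}
    (h : ∀ a b, (eigenvectorOverlap hA hB : Matrix n n 𝕜) a b ≠ 0 →
      f (hA.eigenvalues a) = g (hB.eigenvalues b)) : cfc f A = cfc g B := by
  set U : Matrix n n 𝕜 := ↑hA.eigenvectorUnitary with hU
  set V : Matrix n n 𝕜 := ↑hB.eigenvectorUnitary
  set Df : Matrix n n 𝕜 := diagonal fun a ↦ (f (hA.eigenvalues a) : 𝕜)
  set Dg : Matrix n n 𝕜 := diagonal fun b ↦ (g (hB.eigenvalues b) : 𝕜)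
  have hUU : U * star U = 1 := Unitary.coe_mul_star_self _
  have hVV : V * star V = 1 := Unitary.coe_mul_star_self _
  have hoverlap : (eigenvectorOverlap hA hB : Matrix n n 𝕜) = star U * V := rfl
  have hintertwine : Df * (star U * V) = star U * V * Dg := by
    ext a b
    rw [diagonal_mul, mul_diagonal, ← hoverlap]
    rcases eq_or_ne ((eigenvectorOverlap hA hB : Matrix n n 𝕜) a b) 0 with h0 | h0
    · simp only [h0, mul_zero, zero_mul]
    · rw [h a b h0, mul_comm]
  calc cfc f A = U * (Df * (star U * V)) * star V := by
        rw [cfc_eq_eigenvectorUnitary_mul hA, ← hU, mul_assoc, mul_assoc, mul_assoc, mul_assoc, hVV,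
          mul_one]
    _ = U * star U * (V * Dg * star V) := by rw [hintertwine]; simp only [mul_assoc]
    _ = cfc g B := by rw [hUU, one_mul, cfc_eq_eigenvectorUnitary_mul hB]

end Spectral

section Klein

variable {n : Type*} [Fintype n] [DecidableEq n] {X H C : Matrix n n ℝ}

/-- The unnormalized quantum relative entropy `Tr[X log X - X H - X + e^H]` of `X` with respect to
`e^H`. Taking the exponent `H` as the argument keeps logarithms of singular matrices out of the
definition. -/
noncomputable def relativeEntropy (X H : Matrix n n ℝ) : ℝ :=
  entropy X - (X * H).trace + (cfc Real.exp H).trace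

lemma exp_mul_klFun_div_exp (x h : ℝ) :
    Real.exp h * klFun (x / Real.exp h) = x * Real.log x - x * h - x + Real.exp h := by
  rcases eq_or_ne x 0 with rfl | hx
  · simp [klFun]
  · have hexp := Real.exp_ne_zero h
    rw [klFun, Real.log_div hx hexp, Real.log_exp]
    field_simp
    ring

lemma relativeEntropy_eq_sum (hX : X.IsHermitian) (hH : H.IsHermitian) :
    relativeEntropy X H = ∑ a, ∑ b, Real.exp (hH.eigenvalues b) *
      klFun (hX.eigenvalues a / Real.exp (hH.eigenvalues b)) *
        ‖(eigenvectorOverlap hX hH : Matrix n n ℝ) a b‖ ^ 2 := by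
  have hlog : cfc (fun x : ℝ ↦ x * Real.log x) X * cfc (fun _ ↦ (1 : ℝ)) H =
      X * cfc Real.log X := by
    rw [cfc_const_one ℝ H hH.isSelfAdjoint, mul_one, cfc_mul (fun x ↦ x) Real.log X
      (continuousOn_spectrum _ _) (continuousOn_spectrum _ _), cfc_id' ℝ X hX.isSelfAdjoint]
  have hlin : cfc (fun x : ℝ ↦ x) X * cfc (fun h : ℝ ↦ h) H = X * H := by
    rw [cfc_id' ℝ X hX.isSelfAdjoint, cfc_id' ℝ H hH.isSelfAdjoint]
  have hfst : cfc (fun x : ℝ ↦ x) X * cfc (fun _ ↦ (1 : ℝ)) H = X := by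
    rw [cfc_id' ℝ X hX.isSelfAdjoint, cfc_const_one ℝ H hH.isSelfAdjoint, mul_one]
  have hexp : cfc (fun _ ↦ (1 : ℝ)) X * cfc Real.exp H = cfc Real.exp H := by
    rw [cfc_const_one ℝ X hX.isSelfAdjoint, one_mul]
  rw [relativeEntropy, entropy, ← hlog, ← hlin, ← hexp, ← congrArg trace hfst]
  simp only [trace_cfc_mul_cfc hX hH, RCLike.ofReal_real_eq_id, id_eq, exp_mul_klFun_div_exp,
    ← Finset.sum_sub_distrib, ← Finset.sum_add_distrib]
  exact Finset.sum_congr rfl fun a _ ↦ Finset.sum_congr rfl fun b _ ↦ by ring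

lemma exp_mul_klFun_eigenvalues_mul_nonneg (hX : X.PosSemidef) (hH : H.IsHermitian) (a b : n) :
    0 ≤ Real.exp (hH.eigenvalues b) *
      klFun (hX.isHermitian.eigenvalues a / Real.exp (hH.eigenvalues b)) *
        ‖(eigenvectorOverlap hX.isHermitian hH : Matrix n n ℝ) a b‖ ^ 2 := by
  have := klFun_nonneg (div_nonneg (hX.eigenvalues_nonneg a) (Real.exp_nonneg (hH.eigenvalues b)))
  positivity

theorem relativeEntropy_nonneg (hX : X.PosSemidef) (hH : H.IsHermitian) :
    0 ≤ relativeEntropy X H := by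
  rw [relativeEntropy_eq_sum hX.isHermitian hH]
  exact Finset.sum_nonneg fun a _ ↦ Finset.sum_nonneg fun b _ ↦
    exp_mul_klFun_eigenvalues_mul_nonneg hX hH a b

lemma relativeEntropy_cfc_exp_self (hH : H.IsHermitian) :
    relativeEntropy (cfc Real.exp H) H = 0 := by
  have hlog : cfc Real.log (cfc Real.exp H) = H := by
    rw [← cfc_comp' Real.log Real.exp H ((H.finite_real_spectrum.image _).continuousOn _)
      (continuousOn_spectrum _ _) hH.isSelfAdjoint]
    simp only [Real.log_exp, cfc_id' ℝ H hH.isSelfAdjoint]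
  rw [relativeEntropy, entropy, hlog]
  ring

theorem relativeEntropy_eq_zero_iff (hX : X.PosSemidef) (hH : H.IsHermitian) :
    relativeEntropy X H = 0 ↔ X = cfc Real.exp H := by
  refine ⟨fun h0 ↦ ?_, fun h ↦ h ▸ relativeEntropy_cfc_exp_self hH⟩
  have hterm := exp_mul_klFun_eigenvalues_mul_nonneg hX hH
  rw [relativeEntropy_eq_sum hX.isHermitian hH, Finset.sum_eq_zero_iff_of_nonneg
    fun a _ ↦ Finset.sum_nonneg fun b _ ↦ hterm a b] at h0
  rw [← cfc_id' ℝ X hX.isHermitian]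
  refine cfc_eq_cfc_of_overlap hX.isHermitian hH fun a b hab ↦ ?_
  have hab0 := (Finset.sum_eq_zero_iff_of_nonneg fun b _ ↦ hterm a b).1
    (h0 a (Finset.mem_univ a)) b (Finset.mem_univ b)
  have hkl := (mul_eq_zero.1 ((mul_eq_zero.1 hab0).resolve_right (by simpa using hab))).resolve_left
    (Real.exp_ne_zero _)
  rwa [klFun_eq_zero_iff (div_nonneg (hX.eigenvalues_nonneg a) (Real.exp_nonneg _)),
    div_eq_one_iff_eq (Real.exp_ne_zero _)] at hkl

lemma relativeEntropy_diagonal_sub_smul {β : ℝ} (hβ : β ≠ 0) (C X : Matrix n n ℝ) (d : n → ℝ) :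
    relativeEntropy X (diagonal d - β • C) = β * objective C β X - X.diag ⬝ᵥ d +
      (cfc Real.exp (diagonal d - β • C)).trace := by
  have hdiag : (X * diagonal d).trace = X.diag ⬝ᵥ d := by
    simp only [trace, dotProduct, diag_apply, mul_diagonal]
  rw [relativeEntropy, objective, Matrix.mul_sub, trace_sub, hdiag, Matrix.mul_smul, trace_smul,
    trace_mul_comm X C, smul_eq_mul]
  field_simp
  ring

/-- The first-order optimality condition `log G + β C = diagonal d`, with multipliers `d` for the
constraints on the diagonal, is sufficient because the excess of the objective over its value at
`G` is `β⁻¹` times the relative entropy with respect to `G`. -/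
theorem mem_and_isMinOn_objective_iff {β : ℝ} (hβ : 0 < β) (hC : C.IsHermitian) {d : n → ℝ}
    {G : Matrix n n ℝ} (hG : G = cfc Real.exp (diagonal d - β • C)) {F : Set (Matrix n n ℝ)}
    (hGF : G ∈ F) (hpsd : ∀ Y ∈ F, Y.PosSemidef) (hdiag : ∀ Y ∈ F, Y.diag = G.diag) :
    X ∈ F ∧ IsMinOn (objective C β) F X ↔ X = G := by
  set H := diagonal d - β • C
  have hH : H.IsHermitian := (isHermitian_diagonal d).sub (hC.smul (IsSelfAdjoint.all β))
  have hexcess : ∀ Y ∈ F, relativeEntropy Y H = β * (objective C β Y - objective C β G) := by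
    intro Y hY
    have hGH : relativeEntropy G H = 0 := hG ▸ relativeEntropy_cfc_exp_self hH
    rw [relativeEntropy_diagonal_sub_smul hβ.ne'] at hGH ⊢
    rw [hdiag Y hY]
    linarith
  have hmin : ∀ Y ∈ F, objective C β G ≤ objective C β Y := fun Y hY ↦ by
    have hnonneg := relativeEntropy_nonneg (hpsd Y hY) hH
    rw [hexcess Y hY] at hnonneg
    exact sub_nonneg.1 (nonneg_of_mul_nonneg_right hnonneg hβ)
  constructor
  · rintro ⟨hX, hXmin⟩
    rw [hG, ← relativeEntropy_eq_zero_iff (hpsd X hX) hH, hexcess X hX,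
      le_antisymm (hXmin hGF) (hmin X hX), sub_self, mul_zero]
  · rintro rfl
    exact ⟨hGF, hmin⟩

end Klein

section Fibers

variable {n ι : Type*}

lemma ncard_fiber_pos [Finite n] (c : n → ι) (p : n) : 0 < (c ⁻¹' {c p}).ncard :=
  (Set.ncard_pos (Set.toFinite _)).2 ⟨p, rfl⟩

variable [DecidableEq ι]

/-- The indicator vector of the fiber of `c` over `i`. -/
def fiberIndicator (c : n → ι) (i : ι) : n → ℝ := fun p ↦ if c p = i then 1 else 0

lemma sum_fiber_fiberIndicator [Fintype n] (c : n → ι) (i : ι) (p : n) :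
    ∑ q with c q = c p, fiberIndicator c i q = (c ⁻¹' {i}).ncard * fiberIndicator c i p := by
  have hconst : ∀ q ∈ ({q | c q = c p} : Finset n), fiberIndicator c i q = fiberIndicator c i p :=
    fun q hq ↦ by rw [fiberIndicator, fiberIndicator, (Finset.mem_filter.1 hq).2]
  rw [Finset.sum_congr rfl hconst, Finset.sum_const, nsmul_eq_mul]
  by_cases h : c p = i
  · have hfilter : c ⁻¹' {i} = ({q | c q = c p} : Finset n) := by ext q; simp [h]
    rw [hfilter, Set.ncard_coe_finset]
  · simp only [fiberIndicator, h, if_false, mul_zero]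

variable [DecidableEq n] {c : n → ι}

/-- The matrix that is block-diagonal with respect to the fibers of `c`, with the diagonal block
`a i • 1 + b i • 𝟏𝟏ᵀ` on the fiber over `i`. The data, the minimizers and their logarithms all have
this form. -/
def fiberMatrix (c : n → ι) (a b : ι → ℝ) : Matrix n n ℝ :=
  of fun p q ↦ (if p = q then a (c p) else 0) + if c p = c q then b (c p) else 0

lemma fiberMatrix_apply (a b : ι → ℝ) (p q : n) : fiberMatrix c a b p q =
    (if p = q then a (c p) else 0) + if c p = c q then b (c p) else 0 :=
  rfl

lemma fiberMatrix_apply_self (a b : ι → ℝ) (p : n) :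
    fiberMatrix c a b p p = a (c p) + b (c p) := by
  simp only [fiberMatrix_apply, if_true]

lemma fiberMatrix_apply_of_ne (a b : ι → ℝ) {p q : n} (h : c p ≠ c q) :
    fiberMatrix c a b p q = 0 := by
  rw [fiberMatrix_apply, if_neg (ne_of_apply_ne c h), if_neg h, add_zero]

lemma fiberMatrix_submatrix (a b : ι → ℝ) {s : Set n} [DecidableEq s] {i : ι}
    (hs : ∀ p ∈ s, c p = i) :
    (fiberMatrix c a b).submatrix ((↑) : s → n) (↑) =
      a i • (1 : Matrix s s ℝ) + b i • allOnes s := by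
  ext p q
  simp [fiberMatrix_apply, allOnes, one_apply, hs p p.2, hs q q.2, Subtype.val_inj]

lemma fiberMatrix_congr {a a' b b' : ι → ℝ} (ha : ∀ p, a (c p) = a' (c p))
    (hb : ∀ p, b (c p) = b' (c p)) : fiberMatrix c a b = fiberMatrix c a' b' := by
  ext p q
  rw [fiberMatrix_apply, fiberMatrix_apply, ha, hb]

lemma isHermitian_fiberMatrix (a b : ι → ℝ) : (fiberMatrix c a b).IsHermitian := by
  refine IsHermitian.ext fun p q ↦ ?_
  rcases eq_or_ne (c p) (c q) with h | h
  · simp only [fiberMatrix_apply, h, eq_comm (a := p), star_trivial]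
  · rw [fiberMatrix_apply_of_ne a b h, fiberMatrix_apply_of_ne a b h.symm, star_zero]

lemma diagonal_add_smul_fiberMatrix (a : ι → ℝ) (β : ℝ) :
    diagonal (a ∘ c) + β • fiberMatrix c 0 1 = fiberMatrix c a fun _ ↦ β := by
  ext p q
  simp [fiberMatrix_apply, diagonal_apply]

variable [Fintype n]

lemma fiberMatrix_mulVec (a b : ι → ℝ) (v : n → ℝ) (p : n) :
    (fiberMatrix c a b *ᵥ v) p = a (c p) * v p + b (c p) * ∑ q with c q = c p, v q := by
  simp only [mulVec, dotProduct, fiberMatrix_apply, add_mul, ite_mul, zero_mul,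
    Finset.sum_add_distrib, Finset.sum_ite_eq, Finset.mem_univ, if_true, Finset.sum_filter,
    Finset.mul_sum, mul_ite, mul_zero, eq_comm (a := c p)]

lemma fiberMatrix_mulVec_single (a b : ι → ℝ) (p : n) :
    fiberMatrix c a b *ᵥ Pi.single p 1 =
      a (c p) • Pi.single p 1 + b (c p) • fiberIndicator c (c p) := by
  ext q
  rcases eq_or_ne (c q) (c p) with h | h
  · simp [fiberMatrix_apply, fiberIndicator, Pi.single_apply, h]
  · simp [fiberMatrix_apply, fiberIndicator, h, ne_of_apply_ne c h]

lemma fiberMatrix_mulVec_fiberIndicator (a b : ι → ℝ) (i : ι) :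
    fiberMatrix c a b *ᵥ fiberIndicator c i =
      (a i + b i * (c ⁻¹' {i}).ncard) • fiberIndicator c i := by
  ext p
  rw [fiberMatrix_mulVec, sum_fiber_fiberIndicator, Pi.smul_apply, smul_eq_mul, fiberIndicator]
  split_ifs with h
  · rw [h]
    ring
  · ring

lemma fiberMatrix_mulVec_single_sub (a b : ι → ℝ) (p : n) :
    fiberMatrix c a b *ᵥ
        (Pi.single p 1 - ((c ⁻¹' {c p}).ncard : ℝ)⁻¹ • fiberIndicator c (c p)) =
      a (c p) • (Pi.single p 1 - ((c ⁻¹' {c p}).ncard : ℝ)⁻¹ • fiberIndicator c (c p)) := by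
  have hL : ((c ⁻¹' {c p}).ncard : ℝ) ≠ 0 := Nat.cast_ne_zero.2 (ncard_fiber_pos c p).ne'
  rw [mulVec_sub, mulVec_smul, fiberMatrix_mulVec_single, fiberMatrix_mulVec_fiberIndicator]
  match_scalars <;> field_simp
  ring

theorem cfc_fiberMatrix (f : ℝ → ℝ) (a b : ι → ℝ) :
    cfc f (fiberMatrix c a b) = fiberMatrix c (f ∘ a) fun i ↦
      (f (a i + b i * (c ⁻¹' {i}).ncard) - f (a i)) / (c ⁻¹' {i}).ncard := by
  refine ext_of_mulVec_single fun p ↦ ?_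
  have hherm := isHermitian_fiberMatrix (c := c) a b
  have hcentered := cfc_mulVec_of_mulVec_eq_smul hherm (fiberMatrix_mulVec_single_sub a b p) f
  have hconst := cfc_mulVec_of_mulVec_eq_smul hherm
    (fiberMatrix_mulVec_fiberIndicator a b (c p)) f
  rw [mulVec_sub, mulVec_smul, hconst, sub_eq_iff_eq_add] at hcentered
  rw [hcentered, fiberMatrix_mulVec_single, Function.comp_apply]
  module

end Fibers

section Mixing

variable {L : ℕ}

lemma mixing_denom_pos (β : ℝ) (hL : 0 < L) : 0 < (L : ℝ) + Real.exp (β * L) - 1 := by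
  have hL1 : (1 : ℝ) ≤ L := by exact_mod_cast hL
  linarith [Real.exp_pos (β * L)]

lemma mixing_pos (β : ℝ) (hL : 0 < L) : 0 < mixing β L :=
  div_pos (Nat.cast_pos.2 hL) (mixing_denom_pos β hL)

lemma mixing_mul_exp_sub_one_div (β : ℝ) (hL : 0 < L) :
    mixing β L * (Real.exp (β * L) - 1) / L = 1 - mixing β L := by
  have hden := (mixing_denom_pos β hL).ne'
  have hL0 : (L : ℝ) ≠ 0 := Nat.cast_ne_zero.2 hL.ne'
  rw [mixing, div_mul_eq_mul_div, div_right_comm, mul_div_cancel_left₀ _ hL0, eq_sub_iff_add_eq,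
    ← add_div, div_eq_one_iff_eq hden]
  ring

lemma tendsto_mixing (hL : 0 < L) : Tendsto (mixing · L) atTop (𝓝 0) := by
  have hexp : Tendsto (fun β : ℝ ↦ Real.exp (β * L)) atTop atTop :=
    Real.tendsto_exp_atTop.comp (tendsto_id.atTop_mul_const (Nat.cast_pos.2 hL))
  have hden : Tendsto (fun β : ℝ ↦ L + Real.exp (β * L) - 1) atTop atTop :=
    tendsto_atTop_add_const_right _ (-1) (tendsto_atTop_add_const_left _ _ hexp)
  exact hden.const_div_atTop _

end Mixing

section Gibbs

variable {n ι : Type*} [DecidableEq n] [DecidableEq ι]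

/-- The minimizer `X_β` for the cost `-fiberMatrix c 0 1`: the Gibbs state of this cost at inverse
temperature `β`, normalized to have unit diagonal. -/
noncomputable def gibbsMatrix (c : n → ι) (β : ℝ) : Matrix n n ℝ :=
  fiberMatrix c (fun i ↦ mixing β (c ⁻¹' {i}).ncard) fun i ↦ 1 - mixing β (c ⁻¹' {i}).ncard

lemma gibbsMatrix_apply_self (c : n → ι) (β : ℝ) (p : n) : gibbsMatrix c β p p = 1 := by
  rw [gibbsMatrix, fiberMatrix_apply_self, add_sub_cancel]

lemma gibbsMatrix_apply_of_ne {c : n → ι} (β : ℝ) {p q : n} (h : c p ≠ c q) :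
    gibbsMatrix c β p q = 0 :=
  fiberMatrix_apply_of_ne _ _ h

lemma gibbsMatrix_submatrix {c : n → ι} (β : ℝ) {s : Set n} [DecidableEq s] {i : ι}
    (hs : s = c ⁻¹' {i}) :
    (gibbsMatrix c β).submatrix ((↑) : s → n) (↑) =
      mixing β s.ncard • (1 : Matrix s s ℝ) + (1 - mixing β s.ncard) • allOnes s := by
  subst hs
  exact fiberMatrix_submatrix _ _ fun _ hp ↦ hp

lemma tendsto_gibbsMatrix [Finite n] (c : n → ι) :
    Tendsto (gibbsMatrix c) atTop (𝓝 (fiberMatrix c 0 1)) := by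
  refine tendsto_pi_nhds.2 fun p ↦ tendsto_pi_nhds.2 fun q ↦ ?_
  have hτ := tendsto_mixing (ncard_fiber_pos c p)
  simp only [gibbsMatrix, fiberMatrix_apply, Pi.zero_apply, Pi.one_apply]
  refine Tendsto.add ?_ ?_ <;> split_ifs
  · exact hτ
  · exact tendsto_const_nhds
  · simpa using hτ.const_sub 1
  · exact tendsto_const_nhds

lemma gibbsMatrix_eq_cfc_exp [Fintype n] (c : n → ι) (β : ℝ) :
    gibbsMatrix c β = cfc Real.exp
      (diagonal ((fun i ↦ Real.log (mixing β (c ⁻¹' {i}).ncard)) ∘ c) -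
        β • -fiberMatrix c 0 1) := by
  rw [smul_neg, sub_neg_eq_add, diagonal_add_smul_fiberMatrix, cfc_fiberMatrix, gibbsMatrix]
  have hexplog : ∀ p, Real.exp (Real.log (mixing β (c ⁻¹' {c p}).ncard)) =
      mixing β (c ⁻¹' {c p}).ncard := fun p ↦ Real.exp_log (mixing_pos β (ncard_fiber_pos c p))
  refine fiberMatrix_congr (fun p ↦ (hexplog p).symm) fun p ↦ ?_
  rw [Real.exp_add, hexplog, ← mul_sub_one, mixing_mul_exp_sub_one_div β (ncard_fiber_pos c p)]

lemma posSemidef_gibbsMatrix [Finite n] (c : n → ι) (β : ℝ) : (gibbsMatrix c β).PosSemidef := by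
  cases nonempty_fintype n
  open scoped MatrixOrder in
  rw [gibbsMatrix_eq_cfc_exp, ← nonneg_iff_posSemidef]
  exact cfc_nonneg fun x _ ↦ Real.exp_nonneg x

theorem mem_and_isMinOn_neg_fiberMatrix_iff [Fintype n] (c : n → ι) {β : ℝ} (hβ : 0 < β)
    {F : Set (Matrix n n ℝ)} (hGF : gibbsMatrix c β ∈ F) (hpsd : ∀ Y ∈ F, Y.PosSemidef)
    (hdiag : ∀ Y ∈ F, ∀ p, Y p p = 1) {X : Matrix n n ℝ} :
    X ∈ F ∧ IsMinOn (objective (-fiberMatrix c 0 1) β) F X ↔ X = gibbsMatrix c β := by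
  refine mem_and_isMinOn_objective_iff hβ (isHermitian_fiberMatrix _ _).neg
    (gibbsMatrix_eq_cfc_exp c β) hGF hpsd fun Y hY ↦ funext fun p ↦ ?_
  rw [diag_apply, diag_apply, hdiag Y hY, gibbsMatrix_apply_self]

end Gibbs

section Registry

variable {N M : ℕ} {K : Fin N → ℕ} {P : ∀ i, Matrix (Fin (K i)) (Fin M) ℝ} {r : Relaxation}

/-- The registry point to which a keypoint corresponds, as a function on all keypoints; its fibers
are the sets `I_m`. -/
noncomputable def registryPoint (hP : ∀ i, IsRowPartialPerm (P i)) (p : Keypoint K) : Fin M :=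
  ((hP p.1).row p.2).choose

lemma apply_eq_one_iff (hP : ∀ i, IsRowPartialPerm (P i)) (p : Keypoint K) (m : Fin M) :
    P p.1 p.2 m = 1 ↔ registryPoint hP p = m := by
  obtain ⟨hone, hunique⟩ := ((hP p.1).row p.2).choose_spec
  exact ⟨fun h ↦ (hunique m h).symm, fun h ↦ h ▸ hone⟩

lemma apply_eq_ite (hP : ∀ i, IsRowPartialPerm (P i)) (p : Keypoint K) (m : Fin M) :
    P p.1 p.2 m = if registryPoint hP p = m then 1 else 0 := by
  split_ifs with h
  · exact (apply_eq_one_iff hP p m).2 h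
  · exact ((hP p.1).zero_or_one p.2 m).resolve_right (mt (apply_eq_one_iff hP p m).1 h)

lemma registryClass_eq_preimage (hP : ∀ i, IsRowPartialPerm (P i)) (m : Fin M) :
    registryClass P m = registryPoint hP ⁻¹' {m} :=
  Set.ext fun p ↦ apply_eq_one_iff hP p m

lemma data_eq_fiberMatrix (hP : ∀ i, IsRowPartialPerm (P i)) :
    data P = fiberMatrix (registryPoint hP) 0 1 := by
  ext p q
  simp [data, stack, Matrix.mul_apply, apply_eq_ite hP, fiberMatrix_apply, eq_comm]

lemma registryPoint_injective (hP : ∀ i, IsRowPartialPerm (P i)) (i : Fin N) :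
    Function.Injective fun k : Fin (K i) ↦ registryPoint hP ⟨i, k⟩ := fun k k' h ↦
  (hP i).column k k' _ ((apply_eq_one_iff hP ⟨i, k⟩ _).2 rfl)
    ((apply_eq_one_iff hP ⟨i, k'⟩ _).2 h.symm)

lemma gibbsMatrix_mem_feasible_strong (hP : ∀ i, IsRowPartialPerm (P i)) (β : ℝ) :
    gibbsMatrix (registryPoint hP) β ∈ feasible K .strong := by
  refine ⟨fun i ↦ ?_, posSemidef_gibbsMatrix _ β⟩
  ext k k'
  rcases eq_or_ne k k' with rfl | hne
  · rw [one_apply_eq]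
    exact gibbsMatrix_apply_self _ β _
  · rw [one_apply_ne hne]
    exact gibbsMatrix_apply_of_ne β ((registryPoint_injective hP i).ne hne)

lemma feasible_strong_subset (hK : r = .weak → ∀ i, 0 < K i) :
    feasible K .strong ⊆ feasible K r := by
  rintro X ⟨hblock, hpsd⟩
  have hdiag : ∀ p, X p p = 1 := fun p ↦ by
    simpa [block] using congrFun₂ (hblock p.1) p.2 p.2
  cases r with
  | strong => exact ⟨hblock, hpsd⟩
  | weak =>
    refine ⟨hdiag, fun i ↦ ?_, hpsd⟩
    have hKi : (K i : ℝ) ≠ 0 := Nat.cast_ne_zero.2 (hK rfl i).ne'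
    simp [hblock, Matrix.trace, allOnes, hKi]
  | gw => exact ⟨hdiag, hpsd⟩

lemma feasible_subset_gw : feasible K r ⊆ feasible K .gw := by
  intro X hX
  cases r with
  | strong => exact feasible_strong_subset (by simp) hX
  | weak => exact ⟨hX.1, hX.2.2⟩
  | gw => exact hX

theorem isRegSolution_iff_eq_gibbsMatrix (hP : ∀ i, IsRowPartialPerm (P i))
    (hK : r = .weak → ∀ i, 0 < K i) {β : ℝ} (hβ : 0 < β)
    {X : Matrix (Keypoint K) (Keypoint K) ℝ} :
    IsRegSolution r (-data P) β X ↔ X = gibbsMatrix (registryPoint hP) β := by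
  rw [data_eq_fiberMatrix hP]
  exact mem_and_isMinOn_neg_fiberMatrix_iff _ hβ
    (feasible_strong_subset hK (gibbsMatrix_mem_feasible_strong hP β))
    (fun _ hY ↦ (feasible_subset_gw hY).2) fun _ hY ↦ (feasible_subset_gw hY).1

end Registry

end PermSync

theorem theorem2 {N M : ℕ} (K : Fin N → ℕ) (P : ∀ i, Matrix (Fin (K i)) (Fin M) ℝ)
    (hP : ∀ i, PermSync.IsRowPartialPerm (P i))
    (r : PermSync.Relaxation) (hK : r = PermSync.Relaxation.weak → ∀ i, 0 < K i) :
    (∀ β : ℝ, 0 < β → ∃! X, PermSync.IsRegSolution r (-PermSync.data P) β X) ∧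
    ∀ X : ℝ → Matrix (PermSync.Keypoint K) (PermSync.Keypoint K) ℝ,
      (∀ β : ℝ, 0 < β → PermSync.IsRegSolution r (-PermSync.data P) β (X β)) →
        Filter.Tendsto X Filter.atTop (nhds (PermSync.data P)) ∧
        ∀ β : ℝ, 0 < β →
          (∀ m m' : Fin M, m ≠ m' → ∀ p ∈ PermSync.registryClass P m,
            ∀ q ∈ PermSync.registryClass P m', X β p q = 0) ∧
          ∀ m : Fin M,
            (X β).submatrix (Subtype.val : PermSync.registryClass P m → PermSync.Keypoint K)
                (Subtype.val : PermSync.registryClass P m → PermSync.Keypoint K) =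
              PermSync.mixing β (PermSync.registryClass P m).ncard •
                  (1 : Matrix (PermSync.registryClass P m) (PermSync.registryClass P m) ℝ) +
                (1 - PermSync.mixing β (PermSync.registryClass P m).ncard) •
                  PermSync.allOnes (PermSync.registryClass P m) := by
  have hsol {β : ℝ} (hβ : 0 < β) Y := PermSync.isRegSolution_iff_eq_gibbsMatrix hP hK hβ (X := Y)
  refine ⟨fun β hβ ↦ by simp only [hsol hβ, existsUnique_eq], fun X hX ↦ ?_⟩
  have hX_eq : ∀ β : ℝ, 0 < β → X β = PermSync.gibbsMatrix (PermSync.registryPoint hP) β :=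
    fun β hβ ↦ (hsol hβ _).1 (hX β hβ)
  refine ⟨?_, fun β hβ ↦ ⟨?_, fun m ↦ ?_⟩⟩
  · rw [PermSync.data_eq_fiberMatrix hP]
    refine (PermSync.tendsto_gibbsMatrix _).congr' ?_
    filter_upwards [Filter.eventually_gt_atTop 0] with β hβ using (hX_eq β hβ).symm
  · intro m m' hne p hp q hq
    rw [PermSync.registryClass_eq_preimage hP] at hp hq
    rw [hX_eq β hβ]
    exact PermSync.gibbsMatrix_apply_of_ne β (hp.trans_ne (hne.trans_eq hq.symm))
  · rw [hX_eq β hβ]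
    exact PermSync.gibbsMatrix_submatrix β (PermSync.registryClass_eq_preimage hP m)
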